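/- Consider the noiseless mixed linear regression model. Let $\beta_1^*\neq\beta_2^*$ be vectors in $\mathbb{R}^k$ and let $p_1,p_2>0$ with $p_1+p_2=1$. A batch $\mathcal S$ of $|\mathcal S|=n$ samples $(y_i,\mathbf x_i)$ satisfies $y_i=\langle \mathbf x_i,\beta_1^*\rangle z_i+\langle \mathbf x_i,\beta_2^*\rangle(1-z_i)$, where the $\mathbf x_i$ are i.i.d. $\mathcal N(0,I_k)$ and independent of the hidden labels $z_i\in\{0,1\}$; the labels are either such that (almost surely) exactly $p_1 n$ of them equal $1$ (for instance deterministic labels), or i.i.d. with $\Pr(z_i=1)=p_1$. One EM iteration on $\mathcal S$ from an estimate $(\beta_1,\beta_2)$ sets $$J_1=\{i: |y_i-\langle \mathbf x_i,\beta_1\rangle|<|y_i-\langle \mathbf x_i,\beta_2\rangle|\},\qquad J_2=\mathcal S\setminus J_1,$$ and outputs $\beta_b^+\in\arg\min_{\beta\in\mathbb R^k}\big(\sum_{i\in J_b}(y_i-\langle \mathbf x_i,\beta\rangle)^2\big)^{1/2}$ for $b=1,2$. Write $err=\max_{b}\|\beta_b-\beta_b^*\|_2$ and $err^+=\max_b\|\beta_b^+-\beta_b^*\|_2$.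 There exist absolute constants $\tilde c,c_1,c_2>0$ such that, for all $k$, $n$, $p_1,p_2$, $\beta_1^*,\beta_2^*$ as above and every fixed (not depending on the batch) estimate $(\beta_1,\beta_2)$: if $$err\le \tilde c\,\min\{p_1,p_2\}\,\|\beta_1^*-\beta_2^*\|_2\qquad\text{and}\qquad n\ge \frac{c_1}{\min\{p_1,p_2\}}\,k,$$ then with probability greater than $1-\exp(-c_2k)$ every output $(\beta_1^+,\beta_2^+)$ of the EM iteration (i.e. for every choice of the least-squares minimizers) satisfies $$err^+\le\tfrac12\,err.$$ -/

import Mathlib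

open MeasureTheory ProbabilityTheory

namespace MixedRegression

noncomputable section

/-- `ℝᵏ` with the Euclidean norm. -/
abbrev Vec (k : ℕ) : Type := EuclideanSpace ℝ (Fin k)

/-- The noiseless response `⟨x, β₁⟩ z + ⟨x, β₂⟩ (1 - z)`, where the label `true` stands for `z = 1`
and `false` for `z = 0`. -/
def response {k : ℕ} (β₁ β₂ : Vec k) (z : Bool) (x : Vec k) : ℝ :=
  if z = true then inner ℝ x β₁ else inner ℝ x β₂

/-- The covariates `x i` and the hidden labels `z i` of a batch of `n` samples: the covariates are
i.i.d. standard Gaussian vectors in `ℝᵏ`, and they are independent of the labels. Nothing is said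
here about the joint law of the labels. -/
structure IsGaussianBatch {Ω : Type*} [MeasurableSpace Ω] {k n : ℕ} (μ : Measure Ω)
    (x : Fin n → Ω → Vec k) (z : Fin n → Ω → Bool) : Prop where
  gaussian : ∀ i, HasLaw (x i) (stdGaussian (Vec k)) μ
  indep : iIndepFun x μ
  measurable_label : ∀ i, Measurable (z i)
  indep_label : IndepFun (fun ω i => x i ω) (fun ω i => z i ω) μ

/-- A fraction `p` of the samples of the batch carry the label `true`. Deterministic labels are the
special case in which every `z i` is constant. -/
def HasLabelFraction {Ω : Type*} [MeasurableSpace Ω] {n : ℕ} (μ : Measure Ω)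
    (z : Fin n → Ω → Bool) (p : ℝ) : Prop :=
  ∀ᵐ ω ∂μ, ((Finset.univ.filter fun i => z i ω = true).card : ℝ) = p * n

/-- The labels are i.i.d., equal to `true` with probability `p`. -/
def HasIIDLabels {Ω : Type*} [MeasurableSpace Ω] {n : ℕ} (μ : Measure Ω)
    (z : Fin n → Ω → Bool) (p : ℝ) : Prop :=
  iIndepFun z μ ∧ ∀ i, μ.real {ω | z i ω = true} = p

/-- The set `J₁` of samples that fit `b₁` strictly better than `b₂`. -/
def labelSet₁ {k n : ℕ} (b₁ b₂ : Vec k) (x : Fin n → Vec k) (y : Fin n → ℝ) : Finset (Fin n) :=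
  Finset.univ.filter fun i => |y i - inner ℝ (x i) b₁| < |y i - inner ℝ (x i) b₂|

/-- The set `J₂` of the remaining samples. -/
def labelSet₂ {k n : ℕ} (b₁ b₂ : Vec k) (x : Fin n → Vec k) (y : Fin n → ℝ) : Finset (Fin n) :=
  Finset.univ.filter fun i => ¬ |y i - inner ℝ (x i) b₁| < |y i - inner ℝ (x i) b₂|

/-- The residual norm `‖y_J - X_J b‖₂`. -/
def residualNorm {k n : ℕ} (J : Finset (Fin n)) (x : Fin n → Vec k) (y : Fin n → ℝ)
    (b : Vec k) : ℝ :=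
  √(∑ i ∈ J, (y i - inner ℝ (x i) b) ^ 2)

/-- `b` is a least-squares solution on the samples in `J`, i.e. it is in `argmin ‖y_J - X_J b‖₂`. -/
def IsLeastSquares {k n : ℕ} (J : Finset (Fin n)) (x : Fin n → Vec k) (y : Fin n → ℝ)
    (b : Vec k) : Prop :=
  ∀ b' : Vec k, residualNorm J x y b ≤ residualNorm J x y b'

/-- `(b₁', b₂')` is a possible output of one EM iteration on the batch `(x, y)` from the current
estimate `(b₁, b₂)`. It is a relation, since a least-squares solution need not be unique. -/
def IsEMStep {k n : ℕ} (x : Fin n → Vec k) (y : Fin n → ℝ) (b₁ b₂ b₁' b₂' : Vec k) : Prop :=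
  IsLeastSquares (labelSet₁ b₁ b₂ x y) x y b₁' ∧ IsLeastSquares (labelSet₂ b₁ b₂ x y) x y b₂'

/-- The error of the estimate `(b₁, b₂)` of `(β₁, β₂)`. -/
def err {k : ℕ} (β₁ β₂ b₁ b₂ : Vec k) : ℝ :=
  max ‖b₁ - β₁‖ ‖b₂ - β₂‖

end

end MixedRegression

/-! Write `d = β₁ - β₂` and let `e₁`, `e₂` be the current errors. A sample can be misclassified only
if `|⟨x, d⟩| ≤ |⟨x, e₁⟩| + |⟨x, e₂⟩|`, a condition on the covariate alone; call such samples
ambiguous. Fitting the wrong regressor to such a sample costs `⟨x, d⟩²`, and ambiguity bounds this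
by `2⟨x, e₁⟩² + 2⟨x, e₂⟩²`. So the cost of misclassification is measured by the current error and
not by `‖d‖`, which is what makes the iteration contract.

Two estimates, uniform over directions, then suffice (`err_le_half_of_sum_bounds`). With `D = n
min(p₁, p₂)`, the ambiguous samples must have energy `∑ ⟨x, u⟩²` at most a small multiple of `D
‖u‖²`, and each class must have energy at least a larger multiple. Comparing the least-squares
residual with that of the true regressor gives the contraction.

For the first estimate, ambiguity confines the component of `x` along `d` to an interval of width
proportional to the relative error `r`. That component is independent of the orthogonal one, so
integrating it out shows that exponential moments of `⟨x, u⟩²` restricted to ambiguous samples are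
`O(r)` (`setLIntegral_ambiguousSet_le`). With `r` a small multiple of `min(p₁, p₂)`, Chernoff's
bound gives energy far below `D`. The second estimate is a standard chi-square tail bound. A net of
at most `65 ^ k` directions makes both uniform, with failure probability exponentially small in `k`
once `D` is a large multiple of `k`.

Ambiguity does not involve the labels, so everything is proved for fixed labels; independence then
transfers it to random ones (`measure_mem_le_of_indepFun`). -/

namespace MixedRegression

noncomputable section

/-! ### Sphere nets and the passage from a net to all directions -/

/-- An `ε`-separated subset of the unit ball has at most `(1 + 2 / ε) ^ dim` points. -/
theorem card_le_of_separated {E : Type*} [NormedAddCommGroup E] [NormedSpace ℝ E]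
    [FiniteDimensional ℝ E] {ε : ℝ} (hε : 0 < ε) (s : Finset E) (hs : ∀ c ∈ s, ‖c‖ ≤ 1)
    (h : ∀ c ∈ s, ∀ d ∈ s, c ≠ d → ε ≤ ‖c - d‖) :
    (s.card : ℝ) ≤ (1 + 2 / ε) ^ Module.finrank ℝ E := by
  borelize E
  let μ : Measure E := Measure.addHaar
  have hδ : 0 < ε / 2 := by positivity
  have hρ : 0 < 1 + ε / 2 := by positivity
  have D : Set.Pairwise (s : Set E)
      (Function.onFun Disjoint fun c => Metric.ball (c : E) (ε / 2)) := by
    intro c hc d hd hcd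
    apply Metric.ball_disjoint_ball
    rw [dist_eq_norm]
    linarith [h c hc d hd hcd]
  have hsub : (⋃ c ∈ s, Metric.ball (c : E) (ε / 2)) ⊆ Metric.ball (0 : E) (1 + ε / 2) := by
    refine Set.iUnion₂_subset fun x hx => Metric.ball_subset_ball' ?_
    rw [dist_zero_right]
    linarith [hs x hx]
  -- Volume comparison: the disjoint balls of radius `ε / 2` all lie in the ball of radius `1 + ε /
  -- 2`.
  have I : (s.card : ENNReal) * ENNReal.ofReal ((ε / 2) ^ Module.finrank ℝ E) * μ (Metric.ball 0 1) ≤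
      ENNReal.ofReal ((1 + ε / 2) ^ Module.finrank ℝ E) * μ (Metric.ball 0 1) := by
    calc _ = μ (⋃ c ∈ s, Metric.ball (c : E) (ε / 2)) := by
          rw [measure_biUnion_finset D fun c _ => measurableSet_ball]
          simp only [μ.addHaar_ball_of_pos _ hδ, Finset.sum_const, nsmul_eq_mul, mul_assoc]
      _ ≤ μ (Metric.ball (0 : E) (1 + ε / 2)) := measure_mono hsub
      _ = _ := μ.addHaar_ball_of_pos _ hρ
  have J := (ENNReal.mul_le_mul_iff_left
    (Metric.measure_ball_pos μ _ zero_lt_one).ne' measure_ball_lt_top.ne).1 I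
  have K := ENNReal.toReal_le_of_le_ofReal (pow_nonneg hρ.le _) J
  rw [ENNReal.toReal_mul, ENNReal.toReal_natCast, ENNReal.toReal_ofReal (by positivity),
    ← le_div_iff₀ (by positivity), ← div_pow] at K
  have hbase : 1 + 2 / ε = (1 + ε / 2) / (ε / 2) := by
    field_simp
    ring
  rwa [hbase]

/-- The unit sphere has a finite `ε`-net with at most `(1 + 2 / ε) ^ dim` points. -/
theorem exists_sphere_net {E : Type*} [NormedAddCommGroup E] [NormedSpace ℝ E]
    [FiniteDimensional ℝ E] {ε : ℝ} (hε : 0 < ε) :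
    ∃ N : Finset E, (N.card : ℝ) ≤ (1 + 2 / ε) ^ Module.finrank ℝ E ∧ (∀ u ∈ N, ‖u‖ = 1) ∧
      ∀ u, ‖u‖ = 1 → ∃ v ∈ N, ‖u - v‖ ≤ ε := by
  classical
  let P : Finset E → Prop := fun s => (∀ u ∈ s, ‖u‖ = 1) ∧
    ∀ c ∈ s, ∀ d ∈ s, c ≠ d → ε ≤ ‖c - d‖
  have hcard (s : Finset E) (hs : P s) : (s.card : ℝ) ≤ (1 + 2 / ε) ^ Module.finrank ℝ E :=
    card_le_of_separated hε s (fun c hc => (hs.1 c hc).le) hs.2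
  -- The net is a separated set of largest cardinality, which exists by the packing bound; a point
  -- farther than `ε` from it could be added.
  let C : Set ℕ := {m | ∃ s, P s ∧ s.card = m}
  have hbdd : BddAbove C := by
    refine ⟨⌊(1 + 2 / ε) ^ Module.finrank ℝ E⌋₊, ?_⟩
    rintro m ⟨s, hs, rfl⟩
    exact Nat.le_floor (hcard s hs)
  have hne : C.Nonempty := ⟨0, ∅, ⟨by simp, by simp⟩, rfl⟩
  obtain ⟨N, hN, hNmax⟩ := Nat.sSup_mem hne hbdd
  refine ⟨N, hcard N hN, hN.1, fun u hu => ?_⟩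
  by_contra! hfar
  have hmem : u ∉ N := fun h => by
    have := hfar u h
    simp only [sub_self, norm_zero] at this
    linarith
  have hP : P (insert u N) := by
    refine ⟨fun v hv => ?_, fun c hc d hd hcd => ?_⟩
    · rcases Finset.mem_insert.1 hv with rfl | hv
      exacts [hu, hN.1 v hv]
    · rcases Finset.mem_insert.1 hc with rfl | hc <;> rcases Finset.mem_insert.1 hd with rfl | hd
      · exact absurd rfl hcd
      · exact (hfar d hd).le
      · rw [norm_sub_rev]
        exact (hfar c ‹c ∈ N›).le
      · exact hN.2 c hc d hd hcd
  have := le_csSup hbdd (⟨_, hP, rfl⟩ : (insert u N).card ∈ C)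
  rw [Finset.card_insert_of_notMem hmem, ← hNmax] at this
  omega

section Net

variable {E F : Type*} [NormedAddCommGroup E] [NormedSpace ℝ E] [NormedAddCommGroup F]
  [NormedSpace ℝ F]

/-- Moving to a nearby net point costs at most `‖L‖ / 2`, which is absorbed on the left of `‖L‖ ≤ T
+ ‖L‖ / 2`. -/
theorem opNorm_le_of_net (L : E →L[ℝ] F) {N : Finset E} {ε T : ℝ} (hε : ε ≤ 1 / 2) (hT : 0 ≤ T)
    (hN : ∀ u, ‖u‖ = 1 → ∃ v ∈ N, ‖u - v‖ ≤ ε) (h : ∀ u ∈ N, ‖L u‖ ≤ T) : ‖L‖ ≤ 2 * T := by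
  have hL : ‖L‖ ≤ T + ‖L‖ * (1 / 2) := by
    refine ContinuousLinearMap.opNorm_le_of_unit_norm (by positivity) fun u hu => ?_
    obtain ⟨v, hv, huv⟩ := hN u hu
    calc ‖L u‖ = ‖L v + L (u - v)‖ := by rw [← map_add]; congr 2; abel
      _ ≤ ‖L v‖ + ‖L (u - v)‖ := norm_add_le _ _
      _ ≤ T + ‖L‖ * (1 / 2) := by
        gcongr
        · exact h v hv
        · exact (L.le_opNorm _).trans (by gcongr; exact huv.trans hε)
  linarith

/-- The approximation error here is `‖L‖ * ε`, so a useful lower bound needs an upper bound on `‖L‖`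
first. -/
theorem le_norm_map_of_net (L : E →L[ℝ] F) {N : Finset E} {ε T : ℝ}
    (hN : ∀ u, ‖u‖ = 1 → ∃ v ∈ N, ‖u - v‖ ≤ ε) (h : ∀ u ∈ N, T ≤ ‖L u‖) (u : E) :
    (T - ‖L‖ * ε) * ‖u‖ ≤ ‖L u‖ := by
  rcases eq_or_ne u 0 with rfl | hu
  · simp
  have hu' : ‖u‖ ≠ 0 := norm_ne_zero_iff.2 hu
  obtain ⟨v, hv, huv⟩ := hN (‖u‖⁻¹ • u) (by simp [norm_smul, hu'])
  have h1 : ‖L v‖ ≤ ‖L (‖u‖⁻¹ • u)‖ + ‖L‖ * ε := by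
    calc ‖L v‖ = ‖L (‖u‖⁻¹ • u) - L (‖u‖⁻¹ • u - v)‖ := by rw [← map_sub]; congr 2; abel
      _ ≤ ‖L (‖u‖⁻¹ • u)‖ + ‖L (‖u‖⁻¹ • u - v)‖ := norm_sub_le _ _
      _ ≤ _ := by
        gcongr
        exact (L.le_opNorm _).trans (by gcongr)
  have h2 : ‖L (‖u‖⁻¹ • u)‖ * ‖u‖ = ‖L u‖ := by
    rw [map_smul, norm_smul, norm_inv, norm_norm]
    field_simp
  calc (T - ‖L‖ * ε) * ‖u‖ ≤ ‖L (‖u‖⁻¹ • u)‖ * ‖u‖ := by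
        gcongr
        linarith [h v hv]
    _ = _ := h2

end Net

/-- The operator `u ↦ (⟨x i, u⟩)_{i ∈ S}`. -/
def designOp {k n : ℕ} (S : Finset (Fin n)) (x : Fin n → Vec k) :
    Vec k →L[ℝ] EuclideanSpace ℝ S :=
  (EuclideanSpace.equiv S ℝ).symm.toContinuousLinearMap ∘L
    ContinuousLinearMap.pi fun i : S => innerSL ℝ (x i)

theorem norm_designOp_sq {k n : ℕ} (S : Finset (Fin n)) (x : Fin n → Vec k) (u : Vec k) :
    ‖designOp S x u‖ ^ 2 = ∑ i ∈ S, (inner ℝ (x i) u) ^ 2 := by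
  rw [EuclideanSpace.real_norm_sq_eq, ← Finset.sum_coe_sort S]
  rfl

theorem sum_inner_sq_le_of_net {k n : ℕ} (S : Finset (Fin n)) (x : Fin n → Vec k)
    {N : Finset (Vec k)} {ε T : ℝ} (hε : ε ≤ 1 / 2) (hT : 0 ≤ T)
    (hN : ∀ u, ‖u‖ = 1 → ∃ v ∈ N, ‖u - v‖ ≤ ε)
    (h : ∀ u ∈ N, ∑ i ∈ S, (inner ℝ (x i) u) ^ 2 ≤ T) (u : Vec k) :
    ∑ i ∈ S, (inner ℝ (x i) u) ^ 2 ≤ 4 * T * ‖u‖ ^ 2 := by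
  have hL : ‖designOp S x‖ ≤ 2 * √T := by
    refine opNorm_le_of_net _ hε (Real.sqrt_nonneg T) hN fun v hv => ?_
    refine Real.le_sqrt_of_sq_le ?_
    rw [norm_designOp_sq]
    exact h v hv
  rw [← norm_designOp_sq]
  calc ‖designOp S x u‖ ^ 2 ≤ (2 * √T * ‖u‖) ^ 2 := by
        gcongr
        exact ((designOp S x).le_opNorm u).trans (by gcongr)
    _ = 4 * T * ‖u‖ ^ 2 := by
        rw [mul_pow, mul_pow, Real.sq_sqrt hT]
        ring

/-- In units of `s = √(m / 32)`, the design operator has norm at most `16 s` on the net, hence at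
most `32 s` overall. It has norm at least `2 s` on the net, and mesh `1 / 32` loses at most `s` of
this. -/
theorem le_sum_inner_sq_of_net {k n : ℕ} (S : Finset (Fin n)) (x : Fin n → Vec k)
    {N : Finset (Vec k)} {m : ℝ} (hm : 0 ≤ m)
    (hN : ∀ u, ‖u‖ = 1 → ∃ v ∈ N, ‖u - v‖ ≤ 1 / 32)
    (hle : ∀ u ∈ N, ∑ i ∈ S, (inner ℝ (x i) u) ^ 2 ≤ 8 * m)
    (hge : ∀ u ∈ N, m / 8 ≤ ∑ i ∈ S, (inner ℝ (x i) u) ^ 2) (u : Vec k) :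
    m / 32 * ‖u‖ ^ 2 ≤ ∑ i ∈ S, (inner ℝ (x i) u) ^ 2 := by
  have hsq : √(m / 32) ^ 2 = m / 32 := Real.sq_sqrt (by positivity)
  have hL : ‖designOp S x‖ ≤ 2 * (16 * √(m / 32)) := by
    refine opNorm_le_of_net _ (by norm_num) (by positivity) hN fun v hv => ?_
    refine le_of_sq_le_sq ?_ (by positivity)
    rw [norm_designOp_sq, mul_pow, hsq]
    linarith [hle v hv]
  have hlow := le_norm_map_of_net (designOp S x) (T := 2 * √(m / 32)) hN (fun v hv => by
    refine le_of_sq_le_sq ?_ (norm_nonneg _)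
    rw [norm_designOp_sq, mul_pow, hsq]
    linarith [hge v hv]) u
  rw [← norm_designOp_sq, ← hsq, ← mul_pow]
  gcongr
  refine le_trans ?_ hlow
  gcongr
  linarith

/-! ### Chernoff's bound and Gaussian exponential moments -/

/-- Chernoff's bound for a sum of functions of independent coordinates. -/
theorem measure_pi_le_sum_le {ι X : Type*} [Fintype ι] [MeasurableSpace X] (ν : ι → Measure X)
    [∀ i, IsProbabilityMeasure (ν i)] {φ : ι → X → ℝ} (hφ : ∀ i, Measurable (φ i)) {a : ι → ℝ}
    (h : ∀ i, ∫⁻ x, ENNReal.ofReal (Real.exp (φ i x)) ∂(ν i) ≤ ENNReal.ofReal (Real.exp (a i)))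
    (t : ℝ) :
    Measure.pi ν {x | t ≤ ∑ i, φ i (x i)} ≤ ENNReal.ofReal (Real.exp (∑ i, a i - t)) := by
  let f : ι → (ι → X) → ENNReal := fun i x => ENNReal.ofReal (Real.exp (φ i (x i)))
  have hf (i : ι) : Measurable (f i) :=
    (((hφ i).comp (measurable_pi_apply i)).exp).ennreal_ofReal
  have hind : iIndepFun f (Measure.pi ν) :=
    iIndepFun_pi (X := fun i x => ENNReal.ofReal (Real.exp (φ i x)))
      fun i => ((hφ i).exp.ennreal_ofReal).aemeasurable
  have hprod : ∫⁻ x, ∏ i, f i x ∂(Measure.pi ν) = ∏ i, ∫⁻ x, f i x ∂(Measure.pi ν) :=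
    lintegral_prod_eq_prod_lintegral_of_indepFun Finset.univ f hind hf
  have hint (i : ι) : ∫⁻ x, f i x ∂(Measure.pi ν) ≤ ENNReal.ofReal (Real.exp (a i)) := by
    refine le_trans (le_of_eq ?_) (h i)
    exact (measurePreserving_eval ν i).lintegral_comp (hφ i).exp.ennreal_ofReal
  have hle : ∫⁻ x, ∏ i, f i x ∂(Measure.pi ν) ≤ ENNReal.ofReal (Real.exp (∑ i, a i)) := by
    rw [hprod, Real.exp_sum, ENNReal.ofReal_prod_of_nonneg fun i _ => (Real.exp_pos _).le]
    exact Finset.prod_le_prod' fun i _ => hint i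
  have hset : {x : ι → X | t ≤ ∑ i, φ i (x i)} ⊆
      {x | ENNReal.ofReal (Real.exp t) ≤ ∏ i, f i x} := by
    intro x hx
    simp only [Set.mem_ofPred_eq, f] at hx ⊢
    rw [← ENNReal.ofReal_prod_of_nonneg fun i _ => (Real.exp_pos _).le, ← Real.exp_sum]
    exact ENNReal.ofReal_le_ofReal (Real.exp_le_exp.2 hx)
  have hpos : ENNReal.ofReal (Real.exp t) ≠ 0 := by
    simp [Real.exp_pos]
  calc _ ≤ _ := measure_mono hset
    _ ≤ (∫⁻ x, ∏ i, f i x ∂(Measure.pi ν)) / ENNReal.ofReal (Real.exp t) :=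
      meas_ge_le_lintegral_div (Finset.measurable_prod _ fun i _ => hf i).aemeasurable hpos
        ENNReal.ofReal_ne_top
    _ ≤ ENNReal.ofReal (Real.exp (∑ i, a i)) / ENNReal.ofReal (Real.exp t) := by gcongr
    _ = _ := by
      rw [← ENNReal.ofReal_div_of_pos (Real.exp_pos _), ← Real.exp_sub]

/-- The density of the standard Gaussian, as an extended nonnegative real. -/
theorem lintegral_gaussianReal_zero_one (f : ℝ → ENNReal) (hf : Measurable f) :
    ∫⁻ z, f z ∂(gaussianReal 0 1) =
      ∫⁻ z, ENNReal.ofReal ((√(2 * Real.pi))⁻¹ * Real.exp (-z ^ 2 / 2)) * f z := by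
  rw [gaussianReal_of_var_ne_zero 0 one_ne_zero,
    lintegral_withDensity_eq_lintegral_mul _ (measurable_gaussianPDF 0 1) hf]
  refine lintegral_congr fun z => ?_
  simp [gaussianPDF, gaussianPDFReal]

theorem lintegral_exp_mul_sq_gaussianReal {a : ℝ} (ha : a < 1 / 2) :
    ∫⁻ z, ENNReal.ofReal (Real.exp (a * z ^ 2)) ∂(gaussianReal 0 1) =
      ENNReal.ofReal ((√(1 - 2 * a))⁻¹) := by
  rw [lintegral_gaussianReal_zero_one _ (by fun_prop)]
  have hb : 0 < 1 / 2 - a := by linarith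
  have hfun (z : ℝ) : ENNReal.ofReal ((√(2 * Real.pi))⁻¹ * Real.exp (-z ^ 2 / 2)) *
      ENNReal.ofReal (Real.exp (a * z ^ 2)) =
      ENNReal.ofReal ((√(2 * Real.pi))⁻¹ * Real.exp (-(1 / 2 - a) * z ^ 2)) := by
    rw [← ENNReal.ofReal_mul (by positivity), mul_assoc, ← Real.exp_add]
    congr 3
    ring
  simp_rw [hfun]
  rw [← ofReal_integral_eq_lintegral_ofReal ((integrable_exp_neg_mul_sq hb).const_mul _)
    (Filter.Eventually.of_forall fun z => by positivity), integral_const_mul, integral_gaussian,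
    ← Real.sqrt_inv, ← Real.sqrt_inv, ← Real.sqrt_mul (by positivity)]
  congr 2
  field_simp

theorem map_inner_stdGaussian {k : ℕ} (u : Vec k) :
    (stdGaussian (Vec k)).map (fun x => inner ℝ x u) =
      (gaussianReal 0 1).map (fun z => ‖u‖ * z) := by
  have h := (IsGaussian.hasGaussianLaw_id (μ := stdGaussian (Vec k))).map_fun (innerSL ℝ u)
  have hfun : (fun x : Vec k => inner ℝ x u) = fun x => innerSL ℝ u (id x) := by
    ext x
    simp [real_inner_comm]
  rw [hfun, h.map_eq_gaussianReal, gaussianReal_map_const_mul]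
  have hvar : Var[fun x => innerSL ℝ u (id x); stdGaussian (Vec k)] = ‖u‖ ^ 2 := by
    have := variance_dual_stdGaussian (E := Vec k) (innerSL ℝ u)
    rwa [innerSL_apply_norm] at this
  have hmean : ∫ x, innerSL ℝ u (id x) ∂(stdGaussian (Vec k)) = 0 :=
    integral_strongDual_stdGaussian (innerSL ℝ u)
  rw [hvar, hmean]
  congr 1
  · simp
  · ext
    simp

theorem lintegral_exp_mul_inner_sq_of_norm_eq_one {k : ℕ} {a : ℝ} (ha : a < 1 / 2) {u : Vec k}
    (hu : ‖u‖ = 1) :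
    ∫⁻ x, ENNReal.ofReal (Real.exp (a * (inner ℝ x u) ^ 2)) ∂(stdGaussian (Vec k)) =
      ENNReal.ofReal ((√(1 - 2 * a))⁻¹) := by
  rw [← lintegral_exp_mul_sq_gaussianReal ha,
    ← lintegral_map (f := fun z => ENNReal.ofReal (Real.exp (a * z ^ 2)))
      (g := fun x : Vec k => inner ℝ x u) (by fun_prop) (by fun_prop),
    map_inner_stdGaussian, lintegral_map (by fun_prop) (by fun_prop)]
  simp [hu]

theorem lintegral_exp_mul_inner_sq_le {k : ℕ} {a : ℝ} (ha₀ : 0 ≤ a) (ha : a < 1 / 2) {u : Vec k}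
    (hu : ‖u‖ ≤ 1) :
    ∫⁻ x, ENNReal.ofReal (Real.exp (a * (inner ℝ x u) ^ 2)) ∂(stdGaussian (Vec k)) ≤
      ENNReal.ofReal ((√(1 - 2 * a))⁻¹) := by
  rw [← lintegral_exp_mul_sq_gaussianReal ha,
    ← lintegral_map (f := fun z => ENNReal.ofReal (Real.exp (a * z ^ 2)))
      (g := fun x : Vec k => inner ℝ x u) (by fun_prop) (by fun_prop),
    map_inner_stdGaussian, lintegral_map (by fun_prop) (by fun_prop)]
  refine lintegral_mono fun z => ?_
  refine ENNReal.ofReal_le_ofReal (Real.exp_le_exp.2 (mul_le_mul_of_nonneg_left ?_ ha₀))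
  rw [mul_pow]
  exact mul_le_of_le_one_left (sq_nonneg z) (pow_le_one₀ (norm_nonneg u) hu)

/-- A standard Gaussian gives mass at most `T` to `[-T, T]`, even with an exponential weight. -/
theorem setLIntegral_exp_sq_gaussianReal_le (T : ℝ) :
    ∫⁻ z in {z : ℝ | |z| ≤ T}, ENNReal.ofReal (Real.exp (1 / 8 * z ^ 2)) ∂(gaussianReal 0 1) ≤
      ENNReal.ofReal T := by
  have hmeas : MeasurableSet {z : ℝ | |z| ≤ T} := measurableSet_le (by fun_prop) (by fun_prop)
  have hIcc : {z : ℝ | |z| ≤ T} = Set.Icc (-T) T := by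
    ext z
    exact abs_le (a := z) (b := T)
  rw [← lintegral_indicator hmeas, lintegral_gaussianReal_zero_one _
    (Measurable.indicator (by fun_prop) hmeas)]
  -- The weight `exp (z² / 8)` is absorbed by the Gaussian density, leaving an integrand at most `1
  -- / 2` on an interval of length `2 T`.
  have hpi : (√(2 * Real.pi))⁻¹ ≤ 1 / 2 := by
    rw [one_div]
    refine inv_anti₀ (by norm_num) (Real.le_sqrt_of_sq_le ?_)
    linarith [Real.pi_gt_three]
  calc _ ≤ ∫⁻ z, {z : ℝ | |z| ≤ T}.indicator (fun _ => ENNReal.ofReal (1 / 2)) z := by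
        refine lintegral_mono fun z => ?_
        by_cases hz : z ∈ {z : ℝ | |z| ≤ T}
        · simp only [Set.indicator_of_mem hz]
          rw [← ENNReal.ofReal_mul (by positivity), mul_assoc, ← Real.exp_add]
          refine ENNReal.ofReal_le_ofReal ?_
          have : Real.exp (-z ^ 2 / 2 + 1 / 8 * z ^ 2) ≤ 1 := by
            rw [Real.exp_le_one_iff]
            nlinarith [sq_nonneg z]
          nlinarith [Real.exp_pos (-z ^ 2 / 2 + 1 / 8 * z ^ 2)]
        · simp [Set.indicator_of_notMem hz]
    _ = ENNReal.ofReal T := by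
        rw [lintegral_indicator hmeas, hIcc, setLIntegral_const, Real.volume_Icc,
          ← ENNReal.ofReal_mul (by norm_num)]
        congr 1
        ring

/-! ### Integrating out one direction; the ambiguous set -/

/-- The component of a standard Gaussian along a unit vector is independent of the orthogonal
component. -/
theorem indepFun_inner_sub_smul {k : ℕ} {v : Vec k} (hv : ‖v‖ = 1) :
    IndepFun (fun x : Vec k => (inner ℝ x v : ℝ)) (fun x : Vec k => x - (inner ℝ x v : ℝ) • v)
      (stdGaussian (Vec k)) := by
  have hlaw : HasGaussianLaw (fun x : Vec k => ((inner ℝ x v : ℝ), x - (inner ℝ x v : ℝ) • v))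
      (stdGaussian (Vec k)) := by
    have h := (IsGaussian.hasGaussianLaw_id (μ := stdGaussian (Vec k))).map_fun
      ((innerSL ℝ v).prod (ContinuousLinearMap.id ℝ (Vec k) - (innerSL ℝ v).smulRight v))
    have hfun : (fun x : Vec k => ((inner ℝ x v : ℝ), x - (inner ℝ x v : ℝ) • v)) = fun x =>
        ((innerSL ℝ v).prod (ContinuousLinearMap.id ℝ (Vec k) - (innerSL ℝ v).smulRight v))
          (id x) := by
      ext x <;> simp [real_inner_comm]
    rwa [hfun]
  refine hlaw.indepFun_of_covariance_inner fun s y => ?_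
  -- For a jointly Gaussian pair, vanishing covariance is enough for independence.
  have hcov : cov[fun x : Vec k => inner ℝ (s • v) x,
      fun x : Vec k => inner ℝ (y - (inner ℝ v y : ℝ) • v) x; stdGaussian (Vec k)] = 0 := by
    rw [← covarianceBilin_apply_eq_cov IsGaussian.memLp_two_id, covarianceBilin_stdGaussian,
      innerSL_apply_apply]
    simp only [inner_smul_left, inner_sub_right, inner_smul_right, real_inner_self_eq_norm_sq, hv]
    simp [mul_comm]
  convert hcov using 2
  · ext x
    simp [inner_smul_left, real_inner_comm, mul_comm]
  · ext x
    simp [inner_smul_left, inner_sub_right, inner_sub_left, inner_smul_right, real_inner_comm,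
      mul_comm]

/-- The covariates that the estimate can possibly misclassify, when `d` is the difference of the
two regressors and `e₁`, `e₂` are the errors of the estimate. -/
def ambiguousSet {k : ℕ} (d e₁ e₂ : Vec k) : Set (Vec k) :=
  {x | |inner ℝ x d| ≤ |inner ℝ x e₁| + |inner ℝ x e₂|}

theorem measurableSet_ambiguousSet {k : ℕ} (d e₁ e₂ : Vec k) :
    MeasurableSet (ambiguousSet d e₁ e₂) :=
  measurableSet_le (by fun_prop) (by fun_prop)

theorem norm_sub_inner_smul_le {k : ℕ} {v : Vec k} (hv : ‖v‖ = 1) (w : Vec k) :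
    ‖w - (inner ℝ w v : ℝ) • v‖ ≤ ‖w‖ := by
  refine le_of_sq_le_sq ?_ (norm_nonneg w)
  rw [norm_sub_sq_real, inner_smul_right, norm_smul, hv, mul_one, Real.norm_eq_abs, sq_abs]
  nlinarith [sq_nonneg (inner ℝ w v : ℝ)]

/-- Self-adjointness moves the projection from the Gaussian vector onto the fixed one, so the
one-dimensional moment formulas apply. -/
theorem inner_sub_inner_smul_comm {k : ℕ} (v x w : Vec k) :
    (inner ℝ (x - (inner ℝ x v : ℝ) • v) w : ℝ) = inner ℝ x (w - (inner ℝ w v : ℝ) • v) := by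
  simp only [inner_sub_left, inner_sub_right, real_inner_smul_left, real_inner_smul_right,
    real_inner_comm v w]
  ring

/-- The Gaussian component along the unit vector `v` can be integrated out of a function of it and
of the orthogonal component. -/
theorem lintegral_stdGaussian_eq {k : ℕ} {v : Vec k} (hv : ‖v‖ = 1) {F : ℝ × Vec k → ENNReal}
    (hF : Measurable F) :
    ∫⁻ x, F ((inner ℝ x v : ℝ), x - (inner ℝ x v : ℝ) • v) ∂(stdGaussian (Vec k)) =
      ∫⁻ x, ∫⁻ g, F (g, x - (inner ℝ x v : ℝ) • v) ∂(gaussianReal 0 1) ∂(stdGaussian (Vec k)) := by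
  have hg : Measurable fun x : Vec k => (inner ℝ x v : ℝ) := by fun_prop
  have hP : Measurable fun x : Vec k => x - (inner ℝ x v : ℝ) • v := by fun_prop
  have hpair := (indepFun_iff_map_prod_eq_prod_map_map hg.aemeasurable hP.aemeasurable).1
    (indepFun_inner_sub_smul hv)
  have hmapg : (stdGaussian (Vec k)).map (fun x : Vec k => (inner ℝ x v : ℝ)) =
      gaussianReal 0 1 := by
    rw [map_inner_stdGaussian, hv]
    simp
  rw [← lintegral_map (f := F) hF (hg.prodMk hP), hpair, hmapg]
  have : IsProbabilityMeasure
      ((stdGaussian (Vec k)).map fun x : Vec k => x - (inner ℝ x v : ℝ) • v) :=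
    Measure.isProbabilityMeasure_map hP.aemeasurable
  rw [lintegral_prod_symm _ hF.aemeasurable,
    lintegral_map (hF.lintegral_prod_left') hP]

/-- Use `|h| ≤ 2 exp (h² / 8)`, then `2ab ≤ a² + b²`. This separates two possibly correlated
Gaussians into individual exponential moments. -/
theorem abs_mul_exp_le (h q : ℝ) :
    |h| * Real.exp (1 / 8 * q ^ 2) ≤ Real.exp (1 / 4 * h ^ 2) + Real.exp (1 / 4 * q ^ 2) := by
  have h1 : |h| ≤ 2 * Real.exp (1 / 8 * h ^ 2) := by
    nlinarith [Real.add_one_le_exp (1 / 8 * h ^ 2), sq_nonneg (|h| - 2), sq_abs h]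
  have h2 (t : ℝ) : Real.exp (1 / 4 * t ^ 2) = Real.exp (1 / 8 * t ^ 2) ^ 2 := by
    rw [← Real.exp_nat_mul]
    congr 1
    push_cast
    ring
  rw [h2, h2]
  nlinarith [Real.exp_pos (1 / 8 * q ^ 2),
    sq_nonneg (Real.exp (1 / 8 * h ^ 2) - Real.exp (1 / 8 * q ^ 2))]

/-- The exponential moments of a standard Gaussian on the ambiguous set are of the order of the
relative error `r`. -/
theorem setLIntegral_ambiguousSet_le {k : ℕ} {d e₁ e₂ u : Vec k} {r : ℝ} (hd : d ≠ 0) (hr : 0 < r)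
    (hr' : r ≤ 1 / 4) (he₁ : ‖e₁‖ ≤ r * ‖d‖) (he₂ : ‖e₂‖ ≤ r * ‖d‖) (hu : ‖u‖ ≤ 1) :
    ∫⁻ x in ambiguousSet d e₁ e₂, ENNReal.ofReal (Real.exp (1 / 16 * (inner ℝ x u) ^ 2))
      ∂(stdGaussian (Vec k)) ≤ ENNReal.ofReal (12 * r) := by
  have hd₀ : 0 < ‖d‖ := norm_pos_iff.2 hd
  obtain ⟨v, hv, hdv⟩ : ∃ v : Vec k, ‖v‖ = 1 ∧ d = ‖d‖ • v :=
    ⟨‖d‖⁻¹ • d, by simp [norm_smul, hd₀.ne'], by simp [smul_smul, hd₀.ne']⟩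
  let P : Vec k → Vec k := fun x => x - (inner ℝ x v : ℝ) • v
  -- Half-width of the interval left for `⟨x, v⟩`. Since `r ≤ 1 / 4`, the `v`-components of `e₁` and
  -- `e₂` contribute at most half of `|⟨x, v⟩| ‖d‖`; absorbing this gives the factor `2`.
  let T : Vec k → ℝ := fun y => 2 / ‖d‖ * (|inner ℝ y e₁| + |inner ℝ y e₂|)
  let f : ℝ → ENNReal := fun g => ENNReal.ofReal (Real.exp (1 / 8 * g ^ 2))
  let q : Vec k → ENNReal := fun y => ENNReal.ofReal (Real.exp (1 / 8 * (inner ℝ y u) ^ 2))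
  let G : Set (ℝ × Vec k) := {p | |p.1| ≤ T p.2}
  have hT : Measurable T := by fun_prop
  have hf : Measurable f := by fun_prop
  have hq : Measurable q := by fun_prop
  have hG : MeasurableSet G := measurableSet_le (by fun_prop) (by fun_prop)
  let F : ℝ × Vec k → ENNReal := G.indicator fun p => f p.1 * q p.2
  have hF : Measurable F := Measurable.indicator (by fun_prop) hG
  have hdecomp (x w : Vec k) : (inner ℝ x w : ℝ) = inner ℝ x v * inner ℝ v w + inner ℝ (P x) w := by
    simp only [P, inner_sub_left, real_inner_smul_left]
    ring
  have hpoint (x : Vec k) : (ambiguousSet d e₁ e₂).indicator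
      (fun x => ENNReal.ofReal (Real.exp (1 / 16 * (inner ℝ x u) ^ 2))) x ≤
        F ((inner ℝ x v : ℝ), P x) := by
    by_cases hx : x ∈ ambiguousSet d e₁ e₂
    · have hxd : |(inner ℝ x v : ℝ)| * ‖d‖ ≤ |inner ℝ x e₁| + |inner ℝ x e₂| := by
        have hx' : |(inner ℝ x d : ℝ)| ≤ |inner ℝ x e₁| + |inner ℝ x e₂| := hx
        rw [hdv, real_inner_smul_right, abs_mul, abs_of_pos hd₀] at hx'
        linarith
      have hbd (e : Vec k) (he : ‖e‖ ≤ r * ‖d‖) :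
          |(inner ℝ x e : ℝ)| ≤ |(inner ℝ x v : ℝ)| * (‖d‖ / 4) + |inner ℝ (P x) e| := by
        rw [hdecomp x e]
        refine (abs_add_le _ _).trans ?_
        rw [abs_mul]
        gcongr
        refine (abs_real_inner_le_norm v e).trans ?_
        rw [hv, one_mul]
        nlinarith
      have hmem : ((inner ℝ x v : ℝ), P x) ∈ G := by
        change |(inner ℝ x v : ℝ)| ≤ 2 / ‖d‖ * (|inner ℝ (P x) e₁| + |inner ℝ (P x) e₂|)
        rw [div_mul_eq_mul_div, le_div_iff₀ hd₀]
        linarith [hbd e₁ he₁, hbd e₂ he₂]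
      rw [Set.indicator_of_mem hx]
      simp only [F, Set.indicator_of_mem hmem, f, q]
      rw [← ENNReal.ofReal_mul (Real.exp_pos _).le, ← Real.exp_add]
      refine ENNReal.ofReal_le_ofReal (Real.exp_le_exp.2 ?_)
      -- `(a + b)² ≤ 2a² + 2b²` splits the exponent, turning `1 / 16` into `1 / 8` on each
      -- component.
      have hvu : |(inner ℝ v u : ℝ)| ≤ 1 := by
        refine (abs_real_inner_le_norm v u).trans ?_
        rw [hv, one_mul]
        exact hu
      have hvu2 : (inner ℝ v u : ℝ) ^ 2 ≤ 1 := (sq_le_one_iff_abs_le_one _).2 hvu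
      rw [hdecomp x u]
      nlinarith [sq_nonneg ((inner ℝ x v : ℝ) * inner ℝ v u - inner ℝ (P x) u),
        mul_le_mul_of_nonneg_left hvu2 (sq_nonneg (inner ℝ x v : ℝ))]
    · simp [Set.indicator_of_notMem hx]
  have hinner (y : Vec k) : ∫⁻ g, F (g, y) ∂(gaussianReal 0 1) ≤ ENNReal.ofReal (T y) * q y := by
    have hslice : (fun g => F (g, y)) =
        fun g => ({g : ℝ | |g| ≤ T y}.indicator f g) * q y := by
      ext g
      by_cases hg : |g| ≤ T y
      · have h1 : (g, y) ∈ G := hg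
        have h2 : g ∈ {g : ℝ | |g| ≤ T y} := hg
        simp only [F, Set.indicator_of_mem h1, Set.indicator_of_mem h2]
      · have h1 : (g, y) ∉ G := hg
        have h2 : g ∉ {g : ℝ | |g| ≤ T y} := hg
        simp only [F, Set.indicator_of_notMem h1, Set.indicator_of_notMem h2, zero_mul]
    have hmeas : MeasurableSet {g : ℝ | |g| ≤ T y} :=
      measurableSet_le (by fun_prop) (by fun_prop)
    rw [hslice, lintegral_mul_const _ (hf.indicator hmeas), lintegral_indicator hmeas]
    gcongr
    exact setLIntegral_exp_sq_gaussianReal_le (T y)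
  -- Projected errors rescaled into the unit ball: the scale `r * ‖d‖` cancels the `‖d‖` in `T` and
  -- leaves the factor `2 r`.
  let w : Vec k → Vec k := fun e => (r * ‖d‖)⁻¹ • (e - (inner ℝ e v : ℝ) • v)
  have hrd : 0 < r * ‖d‖ := by positivity
  have hw (e : Vec k) (he : ‖e‖ ≤ r * ‖d‖) : ‖w e‖ ≤ 1 := by
    simp only [w, norm_smul, norm_inv, Real.norm_eq_abs, abs_of_pos hrd]
    rw [inv_mul_le_iff₀ hrd, mul_one]
    exact (norm_sub_inner_smul_le hv e).trans he
  have hwinner (x e : Vec k) : |(inner ℝ (P x) e : ℝ)| = r * ‖d‖ * |inner ℝ x (w e)| := by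
    simp only [P, w]
    rw [inner_sub_inner_smul_comm, real_inner_smul_right, abs_mul, abs_inv, abs_of_pos hrd,
      mul_inv_cancel_left₀ hrd.ne']
  have hPu : ‖u - (inner ℝ u v : ℝ) • v‖ ≤ 1 := (norm_sub_inner_smul_le hv u).trans hu
  let E : Vec k → Vec k → ENNReal := fun a x =>
    ENNReal.ofReal (Real.exp (1 / 4 * (inner ℝ x a) ^ 2))
  have hE (a : Vec k) : Measurable (E a) := by fun_prop
  have hEint (a : Vec k) (ha : ‖a‖ ≤ 1) :
      ∫⁻ x, E a x ∂(stdGaussian (Vec k)) ≤ ENNReal.ofReal (3 / 2) := by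
    refine (lintegral_exp_mul_inner_sq_le (by norm_num) (by norm_num) ha).trans ?_
    -- The moment is `√2 ≤ 3 / 2`; four such terms times `2 r` give `12 r`.
    refine ENNReal.ofReal_le_ofReal ?_
    rw [inv_le_comm₀ (by norm_num) (by norm_num)]
    exact Real.le_sqrt_of_sq_le (by norm_num)
  have hbound (x : Vec k) : ENNReal.ofReal (T (P x)) * q (P x) ≤
      ENNReal.ofReal (2 * r) * (E (w e₁) x + E (w e₂) x +
        (E (u - (inner ℝ u v : ℝ) • v) x + E (u - (inner ℝ u v : ℝ) • v) x)) := by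
    simp only [E, q]
    rw [← ENNReal.ofReal_add (by positivity) (by positivity),
      ← ENNReal.ofReal_add (by positivity) (by positivity),
      ← ENNReal.ofReal_add (by positivity) (by positivity),
      ← ENNReal.ofReal_mul (by positivity), ← ENNReal.ofReal_mul (by positivity)]
    refine ENNReal.ofReal_le_ofReal ?_
    have hPux : (inner ℝ (P x) u : ℝ) = inner ℝ x (u - (inner ℝ u v : ℝ) • v) :=
      inner_sub_inner_smul_comm v x u
    have hTx : T (P x) = 2 * r * (|inner ℝ x (w e₁)| + |inner ℝ x (w e₂)|) := by
      simp only [T, hwinner]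
      field_simp
    rw [hPux, hTx, mul_assoc, add_mul]
    refine mul_le_mul_of_nonneg_left ?_ (by positivity)
    linarith [abs_mul_exp_le (inner ℝ x (w e₁)) (inner ℝ x (u - (inner ℝ u v : ℝ) • v)),
      abs_mul_exp_le (inner ℝ x (w e₂)) (inner ℝ x (u - (inner ℝ u v : ℝ) • v))]
  rw [← lintegral_indicator (measurableSet_ambiguousSet d e₁ e₂)]
  calc _ ≤ ∫⁻ x, F ((inner ℝ x v : ℝ), P x) ∂(stdGaussian (Vec k)) := lintegral_mono hpoint
    _ = ∫⁻ x, ∫⁻ g, F (g, P x) ∂(gaussianReal 0 1) ∂(stdGaussian (Vec k)) :=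
      lintegral_stdGaussian_eq hv hF
    _ ≤ ∫⁻ x, ENNReal.ofReal (2 * r) * (E (w e₁) x + E (w e₂) x +
        (E (u - (inner ℝ u v : ℝ) • v) x + E (u - (inner ℝ u v : ℝ) • v) x))
          ∂(stdGaussian (Vec k)) :=
      lintegral_mono fun x => (hinner (P x)).trans (hbound x)
    _ ≤ ENNReal.ofReal (2 * r) * (ENNReal.ofReal (3 / 2) + ENNReal.ofReal (3 / 2) +
        (ENNReal.ofReal (3 / 2) + ENNReal.ofReal (3 / 2))) := by
      rw [lintegral_const_mul _ (by fun_prop), lintegral_add_left (by fun_prop),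
        lintegral_add_left (by fun_prop), lintegral_add_left (by fun_prop)]
      gcongr
      exacts [hEint _ (hw e₁ he₁), hEint _ (hw e₂ he₂), hEint _ hPu, hEint _ hPu]
    _ = ENNReal.ofReal (12 * r) := by
      rw [← ENNReal.ofReal_add (by norm_num) (by norm_num),
        ← ENNReal.ofReal_add (by norm_num) (by norm_num), ← ENNReal.ofReal_mul (by positivity)]
      congr 1
      ring

/-! ### Deterministic contraction -/

/-- Deterministic part: if the ambiguous samples carry little energy in every direction and each
class carries enough, then one iteration halves the error. -/
theorem err_le_half_of_sum_bounds {k n : ℕ} {β₁ β₂ b₁ b₂ b₁' b₂' : Vec k} {x : Fin n → Vec k}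
    {z : Fin n → Bool} {D : ℝ} (hD : 0 < D) {B : Finset (Fin n)}
    (hBmem : ∀ i, x i ∈ ambiguousSet (β₁ - β₂) (b₁ - β₁) (b₂ - β₂) → i ∈ B)
    (hBamb : ∀ i ∈ B, x i ∈ ambiguousSet (β₁ - β₂) (b₁ - β₁) (b₂ - β₂))
    (hB : ∀ u, ∑ i ∈ B, (inner ℝ (x i) u) ^ 2 ≤ D / 5000 * ‖u‖ ^ 2)
    (hS : ∀ (c : Bool) (u : Vec k),
      D / 64 * ‖u‖ ^ 2 ≤ ∑ i ∈ Finset.univ.filter (fun i => z i = c), (inner ℝ (x i) u) ^ 2)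
    (hstep : IsEMStep x (fun i => response β₁ β₂ (z i) (x i)) b₁ b₂ b₁' b₂') :
    err β₁ β₂ b₁' b₂' ≤ 1 / 2 * err β₁ β₂ b₁ b₂ := by
  classical
  set ρ := err β₁ β₂ b₁ b₂ with hρ
  have hρ₁ : ‖b₁ - β₁‖ ≤ ρ := le_max_left _ _
  have hρ₂ : ‖b₂ - β₂‖ ≤ ρ := le_max_right _ _
  have hρ₀ : 0 ≤ ρ := (norm_nonneg _).trans hρ₁
  -- The energy of the difference of the regressors on the ambiguous samples.
  have henergy : ∑ i ∈ B, (inner ℝ (x i) (β₁ - β₂)) ^ 2 ≤ D / 1250 * ρ ^ 2 := by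
    have h1 : ∑ i ∈ B, (inner ℝ (x i) (β₁ - β₂)) ^ 2 ≤
        ∑ i ∈ B, (2 * (inner ℝ (x i) (b₁ - β₁)) ^ 2 + 2 * (inner ℝ (x i) (b₂ - β₂)) ^ 2) := by
      refine Finset.sum_le_sum fun i hi => ?_
      have h : |(inner ℝ (x i) (β₁ - β₂) : ℝ)| ≤
        |inner ℝ (x i) (b₁ - β₁)| + |inner ℝ (x i) (b₂ - β₂)| := hBamb i hi
      rw [← sq_abs, ← sq_abs (inner ℝ (x i) (b₁ - β₁)), ← sq_abs (inner ℝ (x i) (b₂ - β₂))]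
      nlinarith [abs_nonneg (inner ℝ (x i) (β₁ - β₂) : ℝ),
        sq_nonneg (|(inner ℝ (x i) (b₁ - β₁) : ℝ)| - |(inner ℝ (x i) (b₂ - β₂) : ℝ)|)]
    rw [Finset.sum_add_distrib, ← Finset.mul_sum, ← Finset.mul_sum] at h1
    have h2 : ‖b₁ - β₁‖ ^ 2 ≤ ρ ^ 2 := by gcongr
    have h3 : ‖b₂ - β₂‖ ^ 2 ≤ ρ ^ 2 := by gcongr
    have h4 := hB (b₁ - β₁)
    have h5 := hB (b₂ - β₂)
    nlinarith
  -- Only the comparison of `b'` with the true `β` is used, never uniqueness, so every minimizer is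
  -- covered. The fit has energy at most `4 D / 1250 * ρ²` on `J`, and `J` misses only ambiguous
  -- samples of the class. Hence `(1 / 64 - 1 / 5000) ‖b' - β‖² ≤ 4 / 1250 * ρ²`, which implies a
  -- factor below `1 / 2`.
  have key (J : Finset (Fin n)) (c : Bool) (β b' : Vec k)
      (hclean : ∀ i ∈ J, i ∉ B → response β₁ β₂ (z i) (x i) = inner ℝ (x i) β)
      (hamb : ∀ i ∈ J, (response β₁ β₂ (z i) (x i) - inner ℝ (x i) β) ^ 2 ≤
        (inner ℝ (x i) (β₁ - β₂)) ^ 2)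
      (hJ : ∀ i, z i = c → i ∉ B → i ∈ J)
      (hls : IsLeastSquares J x (fun i => response β₁ β₂ (z i) (x i)) b') :
      ‖b' - β‖ ≤ 1 / 2 * ρ := by
    have hres : ∑ i ∈ J, (response β₁ β₂ (z i) (x i) - inner ℝ (x i) b') ^ 2 ≤
        ∑ i ∈ J, (response β₁ β₂ (z i) (x i) - inner ℝ (x i) β) ^ 2 :=
      (Real.sqrt_le_sqrt_iff (Finset.sum_nonneg fun i _ => sq_nonneg _)).1 (hls β)
    have hres' : ∑ i ∈ J, (response β₁ β₂ (z i) (x i) - inner ℝ (x i) β) ^ 2 ≤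
        ∑ i ∈ B, (inner ℝ (x i) (β₁ - β₂)) ^ 2 := by
      calc _ = ∑ i ∈ J ∩ B, (response β₁ β₂ (z i) (x i) - inner ℝ (x i) β) ^ 2 := by
            refine (Finset.sum_subset Finset.inter_subset_left fun i hi hi' => ?_).symm
            rw [hclean i hi fun hB => hi' (Finset.mem_inter.2 ⟨hi, hB⟩)]
            simp
        _ ≤ ∑ i ∈ J ∩ B, (inner ℝ (x i) (β₁ - β₂)) ^ 2 :=
            Finset.sum_le_sum fun i hi => hamb i (Finset.mem_inter.1 hi).1
        _ ≤ _ := Finset.sum_le_sum_of_subset_of_nonneg Finset.inter_subset_right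
            fun i _ _ => sq_nonneg _
    have hfit : ∑ i ∈ J, (inner ℝ (x i) (b' - β)) ^ 2 ≤
        2 * ∑ i ∈ J, (response β₁ β₂ (z i) (x i) - inner ℝ (x i) b') ^ 2 +
        2 * ∑ i ∈ J, (response β₁ β₂ (z i) (x i) - inner ℝ (x i) β) ^ 2 := by
      rw [Finset.mul_sum, Finset.mul_sum, ← Finset.sum_add_distrib]
      refine Finset.sum_le_sum fun i _ => ?_
      rw [inner_sub_right]
      nlinarith [sq_nonneg ((response β₁ β₂ (z i) (x i) - inner ℝ (x i) b') +
        (response β₁ β₂ (z i) (x i) - inner ℝ (x i) β))]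
    have hlow : ∑ i ∈ Finset.univ.filter (fun i => z i = c), (inner ℝ (x i) (b' - β)) ^ 2 ≤
        ∑ i ∈ J, (inner ℝ (x i) (b' - β)) ^ 2 + ∑ i ∈ B, (inner ℝ (x i) (b' - β)) ^ 2 := by
      rw [← Finset.sum_union_inter]
      refine le_add_of_le_of_nonneg ?_ (Finset.sum_nonneg fun i _ => sq_nonneg _)
      refine Finset.sum_le_sum_of_subset_of_nonneg (fun i hi => ?_) fun i _ _ => sq_nonneg _
      by_cases hiB : i ∈ B
      · exact Finset.mem_union_right _ hiB
      · exact Finset.mem_union_left _ (hJ i (Finset.mem_filter.1 hi).2 hiB)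
    have h1 := hS c (b' - β)
    have h2 := hB (b' - β)
    have h3 : D * ((1 / 64 - 1 / 5000) * ‖b' - β‖ ^ 2) ≤ D * (4 / 1250 * ρ ^ 2) := by linarith
    have h4 := le_of_mul_le_mul_left h3 hD
    refine le_of_sq_le_sq ?_ (by positivity)
    nlinarith [sq_nonneg ρ, sq_nonneg ‖b' - β‖]
  have hneg (i : Fin n) : (inner ℝ (x i) β₂ - inner ℝ (x i) β₁ : ℝ) ^ 2 =
      (inner ℝ (x i) (β₁ - β₂)) ^ 2 := by
    rw [inner_sub_right]
    ring
  have hpos (i : Fin n) : (inner ℝ (x i) β₁ - inner ℝ (x i) β₂ : ℝ) ^ 2 =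
      (inner ℝ (x i) (β₁ - β₂)) ^ 2 := by
    rw [inner_sub_right]
  -- Samples outside `B` are classified correctly.
  have htrue (i : Fin n) (hz : z i = true) (hi : i ∉ B) :
      |response β₁ β₂ (z i) (x i) - inner ℝ (x i) b₁| <
        |response β₁ β₂ (z i) (x i) - inner ℝ (x i) b₂| := by
    -- Ties go to the second set, so only a weak inequality is available here; this is why ambiguity
    -- is defined with `≤`.
    by_contra! h
    refine hi (hBmem i ?_)
    change |(inner ℝ (x i) (β₁ - β₂) : ℝ)| ≤
      |inner ℝ (x i) (b₁ - β₁)| + |inner ℝ (x i) (b₂ - β₂)|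
    simp only [response, hz, if_true] at h
    simp only [inner_sub_right]
    rw [abs_sub_comm (inner ℝ (x i) b₁ : ℝ)]
    calc |(inner ℝ (x i) β₁ - inner ℝ (x i) β₂ : ℝ)|
        ≤ |(inner ℝ (x i) β₁ - inner ℝ (x i) b₂ : ℝ)| + |inner ℝ (x i) b₂ - inner ℝ (x i) β₂| :=
          abs_sub_le _ _ _
      _ ≤ _ := by gcongr
  have hfalse (i : Fin n) (hz : z i = false) (hi : i ∉ B) :
      ¬ |response β₁ β₂ (z i) (x i) - inner ℝ (x i) b₁| <
        |response β₁ β₂ (z i) (x i) - inner ℝ (x i) b₂| := by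
    intro h
    refine hi (hBmem i ?_)
    change |(inner ℝ (x i) (β₁ - β₂) : ℝ)| ≤
      |inner ℝ (x i) (b₁ - β₁)| + |inner ℝ (x i) (b₂ - β₂)|
    simp only [response, hz, Bool.false_eq_true, if_false] at h
    simp only [inner_sub_right]
    rw [abs_sub_comm (inner ℝ (x i) b₂ : ℝ), abs_sub_comm (inner ℝ (x i) β₁ : ℝ)]
    have := abs_sub_le (inner ℝ (x i) β₂ : ℝ) (inner ℝ (x i) b₁) (inner ℝ (x i) β₁)
    linarith
  refine max_le ?_ ?_
  · refine key (labelSet₁ b₁ b₂ x _) true β₁ b₁' (fun i hi hiB => ?_) (fun i _ => ?_)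
      (fun i hz hiB => ?_) hstep.1
    · cases hz : z i
      · exact absurd (Finset.mem_filter.1 hi).2 (hfalse i hz hiB)
      · simp [response]
    · cases hz : z i
      · simp only [response, Bool.false_eq_true, if_false, hneg, le_refl]
      · simp only [response, if_true, sub_self]
        simpa using sq_nonneg (inner ℝ (x i) (β₁ - β₂) : ℝ)
    · exact Finset.mem_filter.2 ⟨Finset.mem_univ i, htrue i hz hiB⟩
  · refine key (labelSet₂ b₁ b₂ x _) false β₂ b₂' (fun i hi hiB => ?_) (fun i _ => ?_)
      (fun i hz hiB => ?_) hstep.2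
    · cases hz : z i
      · simp [response]
      · exact absurd (htrue i hz hiB) (Finset.mem_filter.1 hi).2
    · cases hz : z i
      · simp only [response, Bool.false_eq_true, if_false, sub_self]
        simpa using sq_nonneg (inner ℝ (x i) (β₁ - β₂) : ℝ)
      · simp only [response, if_true, hpos, le_refl]
    · exact Finset.mem_filter.2 ⟨Finset.mem_univ i, hfalse i hz hiB⟩

/-! ### Tail bounds in a single direction -/

/-- The exponent vanishes off the ambiguous set, so its exponential moment is at most `1 + 12 r ≤
exp (12 r)`: each sample contributes only `O(r)`. -/
theorem measure_pi_le_sum_ambiguousSet_le {k n : ℕ} {d e₁ e₂ u : Vec k} {r : ℝ} (hd : d ≠ 0)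
    (hr : 0 < r) (hr' : r ≤ 1 / 4) (he₁ : ‖e₁‖ ≤ r * ‖d‖) (he₂ : ‖e₂‖ ≤ r * ‖d‖) (hu : ‖u‖ ≤ 1)
    (B : (Fin n → Vec k) → Finset (Fin n)) (hB : ∀ X i, i ∈ B X ↔ X i ∈ ambiguousSet d e₁ e₂)
    (T : ℝ) :
    Measure.pi (fun _ : Fin n => stdGaussian (Vec k))
        {X | T ≤ ∑ i ∈ B X, (inner ℝ (X i) u) ^ 2} ≤
      ENNReal.ofReal (Real.exp (n * (12 * r) - T / 16)) := by
  let φ : Vec k → ℝ := (ambiguousSet d e₁ e₂).indicator fun x => 1 / 16 * (inner ℝ x u) ^ 2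
  have hφ : Measurable φ :=
    Measurable.indicator (by fun_prop) (measurableSet_ambiguousSet d e₁ e₂)
  have hmgf : ∫⁻ x, ENNReal.ofReal (Real.exp (φ x)) ∂(stdGaussian (Vec k)) ≤
      ENNReal.ofReal (Real.exp (12 * r)) := by
    calc _ ≤ ∫⁻ x, (1 + (ambiguousSet d e₁ e₂).indicator
            (fun x => ENNReal.ofReal (Real.exp (1 / 16 * (inner ℝ x u) ^ 2))) x)
            ∂(stdGaussian (Vec k)) := by
          refine lintegral_mono fun x => ?_
          by_cases hx : x ∈ ambiguousSet d e₁ e₂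
          · simp only [φ, Set.indicator_of_mem hx]
            exact le_add_self
          · simp [φ, Set.indicator_of_notMem hx]
      _ ≤ 1 + ENNReal.ofReal (12 * r) := by
          rw [lintegral_add_left measurable_const, lintegral_const, measure_univ, one_mul,
            lintegral_indicator (measurableSet_ambiguousSet d e₁ e₂)]
          gcongr
          exact setLIntegral_ambiguousSet_le hd hr hr' he₁ he₂ hu
      _ = ENNReal.ofReal (1 + 12 * r) := by
          rw [ENNReal.ofReal_add zero_le_one (by positivity), ENNReal.ofReal_one]
      _ ≤ _ := ENNReal.ofReal_le_ofReal (by linarith [Real.add_one_le_exp (12 * r)])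
  have hmain := measure_pi_le_sum_le (fun _ : Fin n => stdGaussian (Vec k)) (φ := fun _ => φ)
    (fun _ => hφ) (a := fun _ => 12 * r) (fun _ => hmgf) (T / 16)
  simp only [Finset.sum_const, Finset.card_univ, Fintype.card_fin, nsmul_eq_mul] at hmain
  refine le_trans (measure_mono fun X hX => ?_) hmain
  have hsum : ∑ i, φ (X i) = 1 / 16 * ∑ i ∈ B X, (inner ℝ (X i) u) ^ 2 := by
    rw [Finset.mul_sum, ← Finset.sum_subset (Finset.subset_univ (B X))]
    · refine Finset.sum_congr rfl fun i hi => ?_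
      simp only [φ, Set.indicator_of_mem ((hB X i).1 hi)]
    · intro i _ hi
      simp only [φ, Set.indicator_of_notMem fun h => hi ((hB X i).2 h)]
  have hX' : T ≤ ∑ i ∈ B X, (inner ℝ (X i) u) ^ 2 := hX
  change T / 16 ≤ ∑ i, φ (X i)
  rw [hsum]
  linarith

/-- Chernoff with exponent `-4`: each factor is `1 / √9 = 1 / 3 ≤ exp (-1)`, and the threshold gives
back half of the exponent. -/
theorem measure_pi_sum_inner_sq_le_le {k n : ℕ} {u : Vec k} (hu : ‖u‖ = 1) (S : Finset (Fin n)) :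
    Measure.pi (fun _ : Fin n => stdGaussian (Vec k))
        {X | ∑ i ∈ S, (inner ℝ (X i) u) ^ 2 ≤ S.card / 8} ≤
      ENNReal.ofReal (Real.exp (-(S.card / 2 : ℝ))) := by
  classical
  have hmgf (i : Fin n) : ∫⁻ x, ENNReal.ofReal (Real.exp
      (if i ∈ S then -4 * (inner ℝ x u) ^ 2 else 0)) ∂(stdGaussian (Vec k)) ≤
      ENNReal.ofReal (Real.exp (if i ∈ S then -1 else 0)) := by
    split_ifs
    · rw [lintegral_exp_mul_inner_sq_of_norm_eq_one (by norm_num) hu]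
      refine ENNReal.ofReal_le_ofReal ?_
      rw [Real.exp_neg, show (1 - 2 * (-4) : ℝ) = 3 ^ 2 by norm_num, Real.sqrt_sq (by norm_num)]
      exact inv_anti₀ (Real.exp_pos 1) (by linarith [Real.exp_one_lt_d9])
    · simp
  have hmain := measure_pi_le_sum_le (fun _ : Fin n => stdGaussian (Vec k))
    (φ := fun i x => if i ∈ S then -4 * (inner ℝ x u) ^ 2 else 0)
    (fun i => by split_ifs <;> fun_prop) hmgf (-(S.card / 2))
  simp only [Finset.sum_ite_mem, Finset.univ_inter, ← Finset.mul_sum, Finset.sum_const,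
    nsmul_eq_mul] at hmain
  refine le_trans (measure_mono fun X hX => ?_) (hmain.trans_eq ?_)
  · have hX' : ∑ i ∈ S, (inner ℝ (X i) u) ^ 2 ≤ (S.card : ℝ) / 8 := hX
    change -((S.card : ℝ) / 2) ≤ -4 * ∑ i ∈ S, (inner ℝ (X i) u) ^ 2
    linarith
  · congr 2
    ring

/-- Chernoff with exponent `1 / 4`: each factor is `√2 ≤ exp 1`, against a threshold of `2` per
sample. This upper tail serves only to control the operator norm in the lower bound over the sphere.
-/
theorem measure_pi_le_sum_inner_sq_le {k n : ℕ} {u : Vec k} (hu : ‖u‖ = 1) (S : Finset (Fin n)) :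
    Measure.pi (fun _ : Fin n => stdGaussian (Vec k))
        {X | 8 * S.card ≤ ∑ i ∈ S, (inner ℝ (X i) u) ^ 2} ≤
      ENNReal.ofReal (Real.exp (-(S.card : ℝ))) := by
  classical
  have hmgf (i : Fin n) : ∫⁻ x, ENNReal.ofReal (Real.exp
      (if i ∈ S then 1 / 4 * (inner ℝ x u) ^ 2 else 0)) ∂(stdGaussian (Vec k)) ≤
      ENNReal.ofReal (Real.exp (if i ∈ S then 1 else 0)) := by
    split_ifs
    · rw [lintegral_exp_mul_inner_sq_of_norm_eq_one (by norm_num) hu]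
      refine ENNReal.ofReal_le_ofReal (le_trans ?_ (Real.add_one_le_exp 1))
      rw [inv_le_comm₀ (by norm_num) (by norm_num)]
      exact Real.le_sqrt_of_sq_le (by norm_num)
    · simp
  have hmain := measure_pi_le_sum_le (fun _ : Fin n => stdGaussian (Vec k))
    (φ := fun i x => if i ∈ S then 1 / 4 * (inner ℝ x u) ^ 2 else 0)
    (fun i => by split_ifs <;> fun_prop) hmgf (2 * S.card)
  simp only [Finset.sum_ite_mem, Finset.univ_inter, ← Finset.mul_sum, Finset.sum_const,
    nsmul_eq_mul] at hmain
  refine le_trans (measure_mono fun X hX => ?_) (hmain.trans_eq ?_)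
  · have hX' : 8 * (S.card : ℝ) ≤ ∑ i ∈ S, (inner ℝ (X i) u) ^ 2 := hX
    change 2 * (S.card : ℝ) ≤ 1 / 4 * ∑ i ∈ S, (inner ℝ (X i) u) ^ 2
    linarith
  · congr 2
    ring

/-! ### All directions at once, for fixed labels -/

open Classical in
/-- The covariates for which one iteration from an estimate with errors `e₁`, `e₂` is guaranteed to
succeed, when the labels are `z`. -/
def goodSet {k n : ℕ} (d e₁ e₂ : Vec k) (D : ℝ) (z : Fin n → Bool) : Set (Fin n → Vec k) :=
  {X | (∀ u, ∑ i ∈ Finset.univ.filter (fun i => X i ∈ ambiguousSet d e₁ e₂),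
      (inner ℝ (X i) u) ^ 2 ≤ D / 5000 * ‖u‖ ^ 2) ∧
    ∀ (c : Bool) (u : Vec k),
      D / 64 * ‖u‖ ^ 2 ≤ ∑ i ∈ Finset.univ.filter (fun i => z i = c), (inner ℝ (X i) u) ^ 2}

/-- For fixed labels, with both classes large, the covariates are good with high probability. -/
theorem measure_pi_compl_goodSet_le {k n : ℕ} {d e₁ e₂ : Vec k} {p : ℝ} (hd : d ≠ 0) (hp : 0 < p)
    (hp' : p ≤ 1) (he₁ : ‖e₁‖ ≤ 1 / 10 ^ 7 * p * ‖d‖) (he₂ : ‖e₂‖ ≤ 1 / 10 ^ 7 * p * ‖d‖)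
    {z : Fin n → Bool}
    (hz : ∀ c, p * n / 2 ≤ ((Finset.univ.filter fun i => z i = c).card : ℝ)) :
    Measure.pi (fun _ : Fin n => stdGaussian (Vec k)) (goodSet d e₁ e₂ (p * n) z)ᶜ ≤
      ENNReal.ofReal (5 * 65 ^ k * Real.exp (-(p * n / 10 ^ 6))) := by
  classical
  set P := Measure.pi (fun _ : Fin n => stdGaussian (Vec k)) with hP
  have hD : 0 ≤ p * n := by positivity
  obtain ⟨N, hNcard, hN₁, hN⟩ := exists_sphere_net (E := Vec k) (ε := 1 / 32) (by norm_num)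
  have hNcard' : (N.card : ℝ) ≤ 65 ^ k := by
    refine hNcard.trans_eq ?_
    rw [finrank_euclideanSpace, Fintype.card_fin]
    norm_num
  let B : (Fin n → Vec k) → Finset (Fin n) := fun X =>
    Finset.univ.filter fun i => X i ∈ ambiguousSet d e₁ e₂
  let S : Bool → Finset (Fin n) := fun c => Finset.univ.filter fun i => z i = c
  -- Five events per direction: one for the ambiguous energy and two for each class. The threshold
  -- `1 / 20000` becomes `1 / 5000` after the factor `4` lost in passing from the net to the sphere.
  let bad : Vec k → Set (Fin n → Vec k) := fun u =>
    {X | p * n / 20000 ≤ ∑ i ∈ B X, (inner ℝ (X i) u) ^ 2} ∪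
      ⋃ c : Bool, ({X | ∑ i ∈ S c, (inner ℝ (X i) u) ^ 2 ≤ (S c).card / 8} ∪
        {X | 8 * (S c).card ≤ ∑ i ∈ S c, (inner ℝ (X i) u) ^ 2})
  let η : ENNReal := ENNReal.ofReal (Real.exp (-(p * n / 10 ^ 6)))
  have hη {t : ℝ} (ht : t ≤ -(p * n / 10 ^ 6)) : ENNReal.ofReal (Real.exp t) ≤ η :=
    ENNReal.ofReal_le_ofReal (Real.exp_le_exp.2 ht)
  have hbad (u : Vec k) (hu : u ∈ N) : P (bad u) ≤ 5 * η := by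
    have h1 : P {X | p * n / 20000 ≤ ∑ i ∈ B X, (inner ℝ (X i) u) ^ 2} ≤ η := by
      refine (measure_pi_le_sum_ambiguousSet_le hd (r := 1 / 10 ^ 7 * p) (by positivity)
        (by linarith) he₁ he₂ (hN₁ u hu).le B (fun X i => by simp [B]) _).trans (hη ?_)
      -- Coefficients of `p * n`: `12 / 10 ^ 7 - 1 / 320000 ≤ -1 / 10 ^ 6`. This is where the
      -- smallness of the relative error is used.
      nlinarith
    have h2 (c : Bool) : P ({X | ∑ i ∈ S c, (inner ℝ (X i) u) ^ 2 ≤ (S c).card / 8} ∪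
        {X | 8 * (S c).card ≤ ∑ i ∈ S c, (inner ℝ (X i) u) ^ 2}) ≤ η + η := by
      have hc : p * n / 2 ≤ ((S c).card : ℝ) := hz c
      refine (measure_union_le _ _).trans (add_le_add ?_ ?_)
      · exact (measure_pi_sum_inner_sq_le_le (hN₁ u hu) (S c)).trans (hη (by linarith))
      · exact (measure_pi_le_sum_inner_sq_le (hN₁ u hu) (S c)).trans (hη (by linarith))
    calc P (bad u) ≤ η + ∑ c : Bool, (η + η) := by
          refine (measure_union_le _ _).trans (add_le_add h1 ?_)
          exact (measure_iUnion_fintype_le P _).trans (Finset.sum_le_sum fun c _ => h2 c)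
      _ = 5 * η := by
          simp only [Fintype.sum_bool]
          ring
  have hsub : (goodSet d e₁ e₂ (p * n) z)ᶜ ⊆ ⋃ u ∈ N, bad u := by
    intro X hX
    by_contra hnot
    simp only [Set.mem_iUnion, not_exists] at hnot
    have hnot1 (u : Vec k) (hu : u ∈ N) :
        ∑ i ∈ B X, (inner ℝ (X i) u) ^ 2 ≤ p * n / 20000 := by
      by_contra! h
      exact hnot u hu (Or.inl h.le)
    have hnot2 (c : Bool) (u : Vec k) (hu : u ∈ N) :
        ((S c).card : ℝ) / 8 ≤ ∑ i ∈ S c, (inner ℝ (X i) u) ^ 2 := by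
      by_contra! h
      exact hnot u hu (Or.inr (Set.mem_iUnion.2 ⟨c, Or.inl h.le⟩))
    have hnot3 (c : Bool) (u : Vec k) (hu : u ∈ N) :
        ∑ i ∈ S c, (inner ℝ (X i) u) ^ 2 ≤ 8 * ((S c).card : ℝ) := by
      by_contra! h
      exact hnot u hu (Or.inr (Set.mem_iUnion.2 ⟨c, Or.inr h.le⟩))
    refine hX ⟨fun u => ?_, fun c u => ?_⟩
    · refine (sum_inner_sq_le_of_net (B X) X (by norm_num) (by positivity) hN hnot1 u).trans_eq ?_
      ring
    · refine le_trans ?_ (le_sum_inner_sq_of_net (S c) X (by positivity) hN (hnot3 c) (hnot2 c) u)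
      have hc : p * n / 2 ≤ ((S c).card : ℝ) := hz c
      refine mul_le_mul_of_nonneg_right ?_ (sq_nonneg _)
      linarith
  calc P (goodSet d e₁ e₂ (p * n) z)ᶜ ≤ P (⋃ u ∈ N, bad u) := measure_mono hsub
    _ ≤ ∑ u ∈ N, P (bad u) := measure_biUnion_finset_le N bad
    _ ≤ ∑ u ∈ N, 5 * η := Finset.sum_le_sum hbad
    _ = ENNReal.ofReal (5 * N.card * Real.exp (-(p * n / 10 ^ 6))) := by
        rw [Finset.sum_const, nsmul_eq_mul, ENNReal.ofReal_mul (by positivity),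
          ENNReal.ofReal_mul (by norm_num), ENNReal.ofReal_natCast, ENNReal.ofReal_ofNat]
        ring
    _ ≤ _ := by
        refine ENNReal.ofReal_le_ofReal ?_
        gcongr

/-! ### Random labels -/

/-- Conditioning on an independent variable with finitely many values. -/
theorem measure_mem_le_of_indepFun {Ω X Z : Type*} [MeasurableSpace Ω] [MeasurableSpace X]
    [MeasurableSpace Z] [MeasurableSingletonClass Z] [Fintype Z] {μ : Measure Ω}
    [IsProbabilityMeasure μ] {x : Ω → X} {z : Ω → Z} (hx : AEMeasurable x μ) (hz : Measurable z)
    (hind : IndepFun x z μ) (bad : Z → Set X) (G : Set Z) {η : ENNReal}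
    (h : ∀ c ∈ G, (μ.map x) (bad c) ≤ η) :
    μ {ω | x ω ∈ bad (z ω)} ≤ μ {ω | z ω ∉ G} + η := by
  classical
  -- The sets `bad c` are not assumed measurable; measurable hulls keep their measure and allow
  -- independence to be applied.
  let M : Z → Set X := fun c => toMeasurable (μ.map x) (bad c)
  have hM (c : Z) : MeasurableSet (M c) := measurableSet_toMeasurable _ _
  have hsub : {ω | x ω ∈ bad (z ω)} ⊆ {ω | z ω ∉ G} ∪
      ⋃ c ∈ Finset.univ.filter (· ∈ G), (x ⁻¹' M c ∩ z ⁻¹' {c}) := by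
    intro ω hω
    by_cases hG : z ω ∈ G
    · refine Or.inr (Set.mem_iUnion₂.2 ⟨z ω, by simpa using hG, ?_, rfl⟩)
      exact subset_toMeasurable _ _ hω
    · exact Or.inl hG
  refine (measure_mono hsub).trans ((measure_union_le _ _).trans ?_)
  gcongr
  calc μ (⋃ c ∈ Finset.univ.filter (· ∈ G), (x ⁻¹' M c ∩ z ⁻¹' {c}))
      ≤ ∑ c ∈ Finset.univ.filter (· ∈ G), μ (x ⁻¹' M c ∩ z ⁻¹' {c}) :=
        measure_biUnion_finset_le _ _
    _ ≤ ∑ c ∈ Finset.univ.filter (· ∈ G), η * μ (z ⁻¹' {c}) := by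
        refine Finset.sum_le_sum fun c hc => ?_
        rw [hind.measure_inter_preimage_eq_mul _ _ (hM c) (measurableSet_singleton c),
          ← Measure.map_apply_of_aemeasurable hx (hM c), measure_toMeasurable]
        gcongr
        exact h c (Finset.mem_filter.1 hc).2
    _ ≤ ∑ c, η * μ (z ⁻¹' {c}) :=
        Finset.sum_le_sum_of_subset_of_nonneg (Finset.filter_subset _ _) fun _ _ _ => zero_le
    _ = η := by
        rw [← Finset.mul_sum, sum_measure_preimage_singleton _ fun c _ =>
          hz (measurableSet_singleton c)]
        simp

/-- Lower tail of a binomial variable. -/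
theorem measure_card_label_le {Ω : Type*} [MeasurableSpace Ω] {n : ℕ} {μ : Measure Ω}
    [IsProbabilityMeasure μ] {z : Fin n → Ω → Bool} (hz : ∀ i, Measurable (z i))
    (hind : iIndepFun z μ) {c : Bool} {p q : ℝ} (hpq : p ≤ q) (hq : q ≤ 1)
    (hprob : ∀ i, μ.real {ω | z i ω = c} = q) :
    μ {ω | ((Finset.univ.filter fun i => z i ω = c).card : ℝ) < p * n / 2} ≤
      ENNReal.ofReal (Real.exp (-(p * n / 10))) := by
  have hmap := (iIndepFun_iff_map_fun_eq_pi_map fun i => (hz i).aemeasurable).1 hind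
  have (i : Fin n) : IsProbabilityMeasure (μ.map (z i)) :=
    Measure.isProbabilityMeasure_map (hz i).aemeasurable
  have hc (i : Fin n) : (μ.map (z i)).real {c} = q := by
    rw [map_measureReal_apply (hz i) (measurableSet_singleton c), ← hprob i]
    rfl
  have hc' (i : Fin n) : (μ.map (z i)).real {!c} = 1 - q := by
    rw [← hc i, ← probReal_compl_eq_one_sub (measurableSet_singleton c)]
    congr 1
    ext b
    cases b <;> cases c <;> simp
  have hexp : Real.exp (-1) ≤ 2 / 5 := by
    rw [Real.exp_neg, inv_le_comm₀ (Real.exp_pos 1) (by norm_num)]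
    linarith [Real.exp_one_gt_d9]
  have hq₀ (i : Fin n) : 0 ≤ q := hc i ▸ measureReal_nonneg
  -- The moment is `1 - q (1 - exp (-1)) ≤ 1 - 3q / 5`. Against the threshold `p * n / 2`, the
  -- exponent `3 / 5` leaves `1 / 10`.
  have hmgf (i : Fin n) : ∫⁻ b, ENNReal.ofReal (Real.exp (if b = c then -1 else 0))
      ∂(μ.map (z i)) ≤ ENNReal.ofReal (Real.exp (-(3 / 5 * q))) := by
    have hsum : ∫⁻ b, ENNReal.ofReal (Real.exp (if b = c then -1 else 0)) ∂(μ.map (z i)) =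
        ENNReal.ofReal (Real.exp (-1)) * (μ.map (z i)) {c} + (μ.map (z i)) {!c} := by
      rw [lintegral_fintype, Fintype.sum_bool]
      cases c <;> simp [add_comm]
    rw [hsum, ← ofReal_measureReal, ← ofReal_measureReal, hc, hc',
      ← ENNReal.ofReal_mul (Real.exp_pos _).le,
      ← ENNReal.ofReal_add (mul_nonneg (Real.exp_pos _).le (hq₀ i)) (by linarith)]
    refine ENNReal.ofReal_le_ofReal ?_
    nlinarith [Real.add_one_le_exp (-(3 / 5 * q)), hq₀ i]
  have hmain := measure_pi_le_sum_le (fun i => μ.map (z i))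
    (φ := fun _ b => if b = c then -1 else 0) (fun _ => measurable_of_finite _) hmgf
    (-(p * n / 2))
  rw [← hmap, Measure.map_apply (measurable_pi_lambda _ hz)
    (measurableSet_le measurable_const (by fun_prop))] at hmain
  refine (measure_mono fun ω hω => ?_).trans (hmain.trans ?_)
  · have hω' : ((Finset.univ.filter fun i => z i ω = c).card : ℝ) < p * n / 2 := hω
    change -(p * n / 2) ≤ ∑ i, if z i ω = c then (-1 : ℝ) else 0
    rw [← Finset.sum_filter, Finset.sum_const, nsmul_eq_mul]
    linarith
  · refine ENNReal.ofReal_le_ofReal (Real.exp_le_exp.2 ?_)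
    simp only [Finset.sum_const, Finset.card_univ, Fintype.card_fin, nsmul_eq_mul]
    have : p * n ≤ q * n := by gcongr
    linarith

/-- Both classes are large with high probability. -/
theorem measure_exists_small_class_le {Ω : Type*} [MeasurableSpace Ω] {n : ℕ} {μ : Measure Ω}
    [IsProbabilityMeasure μ] {z : Fin n → Ω → Bool} (hz : ∀ i, Measurable (z i)) {p₁ p₂ : ℝ}
    (hp₁ : 0 < p₁) (hp₂ : 0 < p₂) (hp : p₁ + p₂ = 1)
    (hlab : HasLabelFraction μ z p₁ ∨ HasIIDLabels μ z p₁) :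
    μ {ω | ¬ ∀ c, min p₁ p₂ * n / 2 ≤ ((Finset.univ.filter fun i => z i ω = c).card : ℝ)} ≤
      ENNReal.ofReal (2 * Real.exp (-(min p₁ p₂ * n / 10))) := by
  have h₁ : min p₁ p₂ * n ≤ p₁ * n := by
    gcongr
    exact min_le_left _ _
  have h₂ : min p₁ p₂ * n ≤ p₂ * n := by
    gcongr
    exact min_le_right _ _
  have hmin : 0 ≤ min p₁ p₂ * n := by positivity
  rcases hlab with hfrac | ⟨hind, hprob⟩
  -- With exact label fractions the class sizes are almost surely `p₁ n` and `p₂ n`, so the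
  -- exceptional event is null.
  · refine (le_of_eq ?_).trans zero_le
    change ∀ᵐ ω ∂μ, ∀ c, min p₁ p₂ * n / 2 ≤
      ((Finset.univ.filter fun i => z i ω = c).card : ℝ)
    filter_upwards [hfrac] with ω hω c
    have hcard : ((Finset.univ.filter fun i => z i ω = true).card : ℝ) +
        (Finset.univ.filter fun i => z i ω = false).card = n := by
      have := Finset.card_filter_add_card_filter_not (s := (Finset.univ : Finset (Fin n)))
        (fun i => z i ω = true)
      simp only [Bool.not_eq_true, Finset.card_univ, Fintype.card_fin] at this
      exact_mod_cast this
    have hn : p₁ * n + p₂ * n = n := by rw [← add_mul, hp, one_mul]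
    cases c
    · linarith
    · linarith
  · have hprob' (i : Fin n) : μ.real {ω | z i ω = false} = p₂ := by
      have hcompl : {ω | z i ω = false} = {ω | z i ω = true}ᶜ := by
        ext ω
        simp
      have hmeas : MeasurableSet {ω | z i ω = true} := hz i (measurableSet_singleton true)
      rw [hcompl, probReal_compl_eq_one_sub hmeas, hprob i]
      linarith
    have ht := measure_card_label_le hz hind (min_le_left p₁ p₂) (by linarith) hprob
    have hf := measure_card_label_le hz hind (min_le_right p₁ p₂) (by linarith) hprob'
    calc _ ≤ μ ({ω | ((Finset.univ.filter fun i => z i ω = true).card : ℝ) < min p₁ p₂ * n / 2} ∪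
          {ω | ((Finset.univ.filter fun i => z i ω = false).card : ℝ) < min p₁ p₂ * n / 2}) := by
          refine measure_mono fun ω hω => ?_
          have hω' : ¬ ∀ c, min p₁ p₂ * n / 2 ≤
            ((Finset.univ.filter fun i => z i ω = c).card : ℝ) := hω
          rw [Bool.forall_bool, not_and_or, not_le, not_le] at hω'
          exact hω'.symm
      _ ≤ _ := (measure_union_le _ _).trans (add_le_add ht hf)
      _ = _ := by
          rw [← ENNReal.ofReal_add (by positivity) (by positivity), two_mul]

/-! ### Choice of constants and assembly -/

/-- Both exponentials are at most `exp (-9k)`, and the prefactor is at most `7 * 65 ^ k ≤ exp (2k)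
exp (5k)`. The total `exp (-2k)` is strictly below `exp (-k)` because `k > 0`. -/
theorem failure_probability_lt {k : ℕ} (hk : 0 < k) {D : ℝ} (hD : 9 * 10 ^ 6 * (k : ℝ) ≤ D) :
    2 * Real.exp (-(D / 10)) + 5 * 65 ^ k * Real.exp (-(D / 10 ^ 6)) < Real.exp (-(k : ℝ)) := by
  have hk' : (1 : ℝ) ≤ k := by exact_mod_cast hk
  have h1 : Real.exp (-(D / 10)) ≤ Real.exp (-(9 * (k : ℝ))) :=
    Real.exp_le_exp.2 (by linarith)
  have h2 : Real.exp (-(D / 10 ^ 6)) ≤ Real.exp (-(9 * (k : ℝ))) :=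
    Real.exp_le_exp.2 (by linarith)
  have he : (2.7 : ℝ) ≤ Real.exp 1 := by linarith [Real.exp_one_gt_d9]
  have h65 : (65 : ℝ) ^ k ≤ Real.exp (5 * k) := by
    have : (65 : ℝ) ≤ Real.exp 5 := by
      calc (65 : ℝ) ≤ 2.7 ^ 5 := by norm_num
        _ ≤ Real.exp 1 ^ 5 := by gcongr
        _ = Real.exp 5 := by
          rw [← Real.exp_nat_mul]
          norm_num
    calc (65 : ℝ) ^ k ≤ Real.exp 5 ^ k := by gcongr
      _ = Real.exp (5 * k) := by rw [← Real.exp_nat_mul, mul_comm]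
  have h7 : (7 : ℝ) ≤ Real.exp (2 * k) := by
    calc (7 : ℝ) ≤ 2.7 ^ 2 := by norm_num
      _ ≤ Real.exp 1 ^ 2 := by gcongr
      _ = Real.exp 2 := by
        rw [← Real.exp_nat_mul]
        norm_num
      _ ≤ _ := Real.exp_le_exp.2 (by linarith)
  have h1' : (1 : ℝ) ≤ 65 ^ k := one_le_pow₀ (by norm_num)
  calc _ ≤ 2 * Real.exp (-(9 * (k : ℝ))) + 5 * 65 ^ k * Real.exp (-(9 * (k : ℝ))) := by gcongr
    _ ≤ 7 * 65 ^ k * Real.exp (-(9 * (k : ℝ))) := by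
      nlinarith [Real.exp_pos (-(9 * (k : ℝ)))]
    _ ≤ Real.exp (2 * k) * Real.exp (5 * k) * Real.exp (-(9 * (k : ℝ))) := by gcongr
    _ = Real.exp (-(2 * (k : ℝ))) := by
      rw [← Real.exp_add, ← Real.exp_add]
      congr 1
      ring
    _ < Real.exp (-(k : ℝ)) := Real.exp_lt_exp.2 (by linarith)

end

end MixedRegression

theorem mainTheorem1 :
    ∃ c₀ c₁ c₂ : ℝ, 0 < c₀ ∧ 0 < c₁ ∧ 0 < c₂ ∧
      ∀ (k n : ℕ) (p₁ p₂ : ℝ), 0 < p₁ → 0 < p₂ → p₁ + p₂ = 1 →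
      ∀ β₁ β₂ : MixedRegression.Vec k, β₁ ≠ β₂ →
      ∀ b₁ b₂ : MixedRegression.Vec k,
        MixedRegression.err β₁ β₂ b₁ b₂ ≤ c₀ * min p₁ p₂ * ‖β₁ - β₂‖ →
        c₁ / min p₁ p₂ * (k : ℝ) ≤ (n : ℝ) →
      ∀ (Ω : Type*) [MeasurableSpace Ω] (μ : MeasureTheory.Measure Ω)
        [MeasureTheory.IsProbabilityMeasure μ]
        (x : Fin n → Ω → MixedRegression.Vec k) (z : Fin n → Ω → Bool),
        MixedRegression.IsGaussianBatch μ x z →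
        (MixedRegression.HasLabelFraction μ z p₁ ∨ MixedRegression.HasIIDLabels μ z p₁) →
        ∃ A : Set Ω, MeasurableSet A ∧ 1 - Real.exp (-(c₂ * (k : ℝ))) < μ.real A ∧
          ∀ ω ∈ A, ∀ b₁' b₂' : MixedRegression.Vec k,
            MixedRegression.IsEMStep (fun i => x i ω)
              (fun i => MixedRegression.response β₁ β₂ (z i ω) (x i ω)) b₁ b₂ b₁' b₂' →
            MixedRegression.err β₁ β₂ b₁' b₂' ≤ 1 / 2 * MixedRegression.err β₁ β₂ b₁ b₂ := by

  refine ⟨1 / 10 ^ 7, 9 * 10 ^ 6, 1, by norm_num, by norm_num, by norm_num, ?_⟩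
  intro k n p₁ p₂ hp₁ hp₂ hp β₁ β₂ hβ b₁ b₂ herr hn Ω _ μ _ x z hbatch hlab
  classical
  have hpmin : 0 < min p₁ p₂ := lt_min hp₁ hp₂
  have hpmin' : min p₁ p₂ ≤ 1 := (min_le_left _ _).trans (by linarith)
  have hd : β₁ - β₂ ≠ 0 := sub_ne_zero.2 hβ
  -- Dimension zero is excluded by `β₁ ≠ β₂`; the strict probability bound needs this.
  have hk : 0 < k := by
    rcases Nat.eq_zero_or_pos k with rfl | hk
    · exact absurd (Subsingleton.elim β₁ β₂) hβ
    · exact hk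
  have hD : 9 * 10 ^ 6 * (k : ℝ) ≤ min p₁ p₂ * n := by
    rw [div_mul_eq_mul_div, div_le_iff₀ hpmin] at hn
    linarith
  have hDpos : 0 < min p₁ p₂ * n := by
    have : (1 : ℝ) ≤ k := by exact_mod_cast hk
    linarith
  have hx (i : Fin n) : AEMeasurable (x i) μ := (hbatch.gaussian i).aemeasurable
  have hmap : μ.map (fun ω i => x i ω) =
      Measure.pi fun _ : Fin n => stdGaussian (MixedRegression.Vec k) := by
    rw [(iIndepFun_iff_map_fun_eq_pi_map hx).1 hbatch.indep]
    congr 1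
    ext1 i
    exact (hbatch.gaussian i).map_eq
  let good : (Fin n → Bool) → Set (Fin n → MixedRegression.Vec k) :=
    MixedRegression.goodSet (β₁ - β₂) (b₁ - β₁) (b₂ - β₂) (min p₁ p₂ * n)
  let G : Set (Fin n → Bool) :=
    {c | ∀ l, min p₁ p₂ * n / 2 ≤ ((Finset.univ.filter fun i => c i = l).card : ℝ)}
  let F : Set Ω := {ω | (fun i => x i ω) ∈ (good fun i => z i ω)ᶜ}
  have hF : μ F ≤ ENNReal.ofReal (2 * Real.exp (-(min p₁ p₂ * n / 10)) +
      5 * 65 ^ k * Real.exp (-(min p₁ p₂ * n / 10 ^ 6))) := by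
    rw [ENNReal.ofReal_add (by positivity) (by positivity)]
    refine (MixedRegression.measure_mem_le_of_indepFun (aemeasurable_pi_lambda _ hx)
      (measurable_pi_lambda _ hbatch.measurable_label) hbatch.indep_label (fun c => (good c)ᶜ) G
      (fun c hc => ?_)).trans (add_le_add_left
        (MixedRegression.measure_exists_small_class_le hbatch.measurable_label hp₁ hp₂ hp hlab) _)
    rw [hmap]
    exact MixedRegression.measure_pi_compl_goodSet_le hd hpmin hpmin'
      ((le_max_left _ _).trans herr) ((le_max_right _ _).trans herr) hc
  have hFreal : μ.real F < Real.exp (-(1 * (k : ℝ))) := by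
    rw [one_mul]
    exact (ENNReal.toReal_le_of_le_ofReal (by positivity) hF).trans_lt
      (MixedRegression.failure_probability_lt hk hD)
  -- Measurability of the failure set `F` is not established; the complement of its measurable hull
  -- is a measurable success event with the same bound.
  refine ⟨(toMeasurable μ F)ᶜ, (measurableSet_toMeasurable μ F).compl, ?_, ?_⟩
  · rw [probReal_compl_eq_one_sub (measurableSet_toMeasurable μ F)]
    have : μ.real (toMeasurable μ F) = μ.real F := by
      simp only [Measure.real, measure_toMeasurable]
    linarith
  · intro ω hω b₁' b₂' hstep
    have hgood : (fun i => x i ω) ∈ good fun i => z i ω := by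
      by_contra h
      exact hω (subset_toMeasurable μ F h)
    exact MixedRegression.err_le_half_of_sum_bounds hDpos
      (fun i hi => Finset.mem_filter.2 ⟨Finset.mem_univ i, hi⟩)
      (fun i hi => (Finset.mem_filter.1 hi).2) hgood.1 hgood.2 hstep
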